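/- For $n\ge 1$ let $\mathsf{baxt}_n$ be the Baxter monoid of rank $n$: the quotient of the free monoid on the ordered alphabet $\{1<2<\cdots<n\}$ by the congruence that identifies two words $w,w'$ when they yield the same pair of binary search trees, namely (a) the tree obtained by reading the word from left to right and inserting each letter $a$ as a leaf, going left at a node labelled $x$ if $a<x$ and right otherwise, and (b) the tree obtained by reading the word from right to left and inserting each letter $a$ as a leaf, going right at a node labelled $x$ if $a>x$ and left otherwise. It is an involution monoid under Schützenberger's involution ${}^\sharp$, induced by $w_1w_2\cdots w_m\mapsto w_m^\sharp\cdots w_2^\sharp w_1^\sharp$ with $i^\sharp=n+1-i$. Terms are built from countably many variables and the empty term by (associative) concatenation, with the empty term as unit, and a unary operation ${}^*$; an identity $p\approx q$ is a pair of terms, and it holds in an involution monoid if both sides take the same value under every substitution of elements for the variables. An identity is deducible from a set $\Sigma$ of identities if its two sides are joined by a finite chain of terms in which each step replaces a subterm $\varphi(p)$ by $\varphi(q)$, where $p\approx q$ or $q\approx p$ is in $\Sigma$ and $\varphi$ is a substitution of (possibly empty) terms for variables. A set $\Sigma$ of identities of an involution monoid is an identity basis for it if every identity of the involution monoid is deducible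 from $\Sigma$; the involution monoid is finitely based if it has a finite identity basis. **Theorem.** The involution axioms $(x^*)^*\approx x$ and $(xy)^*\approx y^*x^*$, the identities \begin{align*} &x^*hxk\,xy\,sx^*tx\approx x^*hxk\,yx\,sx^*tx, && x^*hxk\,xy\,sxtx^*\approx x^*hxk\,yx\,sxtx^*,\\ &xhx^*k\,xy\,sx^*tx\approx xhx^*k\,yx\,sx^*tx, && xhx^*k\,xy\,sxtx^*\approx xhx^*k\,yx\,sxtx^*; \tag{5.1}\\ &x^*hxk\,xy\,sy^*ty\approx x^*hxk\,yx\,sy^*ty, && x^*hxk\,xy\,syty^*\approx x^*hxk\,yx\,syty^*,\\ &xhx^*k\,xy\,sy^*ty\approx xhx^*k\,yx\,sy^*ty, && xhx^*k\,xy\,syty^*\approx xhx^*k\,yx\,syty^*; \tag{5.2}\\ &xhyk\,xy\,sxty\approx xhyk\,yx\,sxty, && xhyk\,xy\,sytx\approx xhyk\,yx\,sytx; \tag{5.3}\\ &xhyk\,xy\,sx^*ty^*\approx xhyk\,yx\,sx^*ty^*, && xhyk\,xy\,sy^*tx^*\approx xhyk\,yx\,sy^*tx^*; \tag{5.4}\\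 &x^*hy^*k\,xy\,sx^*ty^*\approx x^*hy^*k\,yx\,sx^*ty^*, && x^*hy^*k\,xy\,sy^*tx^*\approx x^*hy^*k\,yx\,sy^*tx^*; \tag{5.5}\\ &x^*hxk\,xy\,sxty\approx x^*hxk\,yx\,sxty, && x^*hxk\,xy\,sytx\approx x^*hxk\,yx\,sytx,\\ &xhx^*k\,xy\,sxty\approx xhx^*k\,yx\,sxty, && xhx^*k\,xy\,sytx\approx xhx^*k\,yx\,sytx; \tag{5.6}\\ &x^*hxk\,xy\,sx^*ty^*\approx x^*hxk\,yx\,sx^*ty^*, && x^*hxk\,xy\,sy^*tx^*\approx x^*hxk\,yx\,sy^*tx^*,\\ &xhx^*k\,xy\,sx^*ty^*\approx xhx^*k\,yx\,sx^*ty^*, && xhx^*k\,xy\,sy^*tx^*\approx xhx^*k\,yx\,sy^*tx^*, \tag{5.7} \end{align*} and the reverses of the identities (5.1)–(5.7) (both sides written backwards, each letter keeping its star) form a finite identity basis for $(\mathsf{baxt}_2,{}^\sharp)$. Hence $(\mathsf{baxt}_2,{}^\sharp)$ is finitely based. -/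

import Mathlib

namespace BaxterInvolution

/-! ### Binary search tree insertion -/

section Trees

variable {α β : Type*} [LinearOrder α] [LinearOrder β]

/-- Insertion of `a` into a right strict binary search tree. -/
def insertRightStrict (a : α) : BinaryTree α → BinaryTree α
  | .nil => .node a .nil .nil
  | .node x l r =>
      if x < a then .node x l (insertRightStrict a r) else .node x (insertRightStrict a l) r

/-- Insertion of `a` into a left strict binary search tree. -/
def insertLeftStrict (a : α) : BinaryTree α → BinaryTree α
  | .nil => .node a .nil .nil
  | .node x l r =>
      if a < x then .node x (insertLeftStrict a l) r else .node x l (insertLeftStrict a r)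

/-- The sylvester tree of a word: read the word from right to left, starting from the empty tree,
and insert each letter into a right strict binary search tree. -/
def sylvTree (w : List α) : BinaryTree α := w.foldr insertRightStrict .nil

/-- The sharp-sylvester tree of a word: read the word from left to right, starting from the empty
tree, and insert each letter into a left strict binary search tree. -/
def sylvSharpTree (w : List α) : BinaryTree α := w.foldl (fun T a => insertLeftStrict a T) .nil

/-- The pair of twin binary search trees associated with a word. -/
def baxterSymbol (w : List α) : BinaryTree α × BinaryTree α := (sylvSharpTree w, sylvTree w)

/-! Auxiliary facts: equality of twin trees is a congruence, compatible with the involution. -/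

/-- Remove from a right strict search tree all labels `≤ x`. -/
def cutGt (x : α) : BinaryTree α → BinaryTree α
  | .nil => .nil
  | .node y l r => if x < y then .node y (cutGt x l) r else cutGt x r

/-- Remove from a right strict search tree all labels `> x`. -/
def cutLe (x : α) : BinaryTree α → BinaryTree α
  | .nil => .nil
  | .node y l r => if x < y then cutLe x l else .node y l (cutLe x r)

theorem cutGt_insert (x a : α) (T : BinaryTree α) :
    cutGt x (insertRightStrict a T)
      = if x < a then insertRightStrict a (cutGt x T) else cutGt x T := by
  induction T with
  | nil => simp [insertRightStrict, cutGt]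
  | node y l r ihl ihr =>
    by_cases h1 : y < a <;> by_cases h2 : x < y <;> by_cases h3 : x < a <;>
      first
        | (exfalso; order)
        | simp [insertRightStrict, cutGt, h1, h2, h3, ihl, ihr]

theorem cutLe_insert (x a : α) (T : BinaryTree α) :
    cutLe x (insertRightStrict a T)
      = if x < a then cutLe x T else insertRightStrict a (cutLe x T) := by
  induction T with
  | nil => simp [insertRightStrict, cutLe]
  | node y l r ihl ihr =>
    by_cases h1 : y < a <;> by_cases h2 : x < y <;> by_cases h3 : x < a <;>
      first
        | (exfalso; order)
        | simp [insertRightStrict, cutLe, h1, h2, h3, ihl, ihr]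

theorem sylvTree_filter_gt (x : α) (w : List α) :
    sylvTree (w.filter (fun a => x < a)) = cutGt x (sylvTree w) := by
  induction w with
  | nil => rfl
  | cons a w ih =>
    have h : sylvTree (a :: w) = insertRightStrict a (sylvTree w) := rfl
    rw [h, cutGt_insert, ← ih]
    by_cases hx : x < a <;> simp [hx, sylvTree]

theorem sylvTree_filter_le (x : α) (w : List α) :
    sylvTree (w.filter (fun a => ¬ x < a)) = cutLe x (sylvTree w) := by
  induction w with
  | nil => rfl
  | cons a w ih =>
    have h : sylvTree (a :: w) = insertRightStrict a (sylvTree w) := rfl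
    rw [h, cutLe_insert, ← ih]
    by_cases hx : x < a
    · rw [List.filter_cons_of_neg (by simpa using hx), if_pos hx]
    · rw [List.filter_cons_of_pos (by simpa using hx), if_neg hx]; rfl

theorem foldr_insert_node (u : List α) (x : α) (l r : BinaryTree α) :
    u.foldr insertRightStrict (.node x l r)
      = .node x ((u.filter (fun a => ¬ x < a)).foldr insertRightStrict l)
          ((u.filter (fun a => x < a)).foldr insertRightStrict r) := by
  induction u with
  | nil => rfl
  | cons a u ih =>
    rw [List.foldr_cons, ih]
    by_cases hx : x < a
    · rw [List.filter_cons_of_neg (by simpa using hx), List.filter_cons_of_pos (by simpa using hx)]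
      simp [insertRightStrict, hx]
    · rw [List.filter_cons_of_pos (by simpa using hx), List.filter_cons_of_neg (by simpa using hx)]
      simp only [insertRightStrict, hx, if_false, List.foldr_cons]

theorem foldr_insert_congr (T : BinaryTree α) :
    ∀ u v : List α, sylvTree u = sylvTree v →
      u.foldr insertRightStrict T = v.foldr insertRightStrict T := by
  induction T with
  | nil => intro u v h; exact h
  | node x l r ihl ihr =>
    intro u v h
    rw [foldr_insert_node, foldr_insert_node]
    rw [ihl _ (v.filter (fun a => ¬ x < a)) (by rw [sylvTree_filter_le, sylvTree_filter_le, h]),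
      ihr _ (v.filter (fun a => x < a)) (by rw [sylvTree_filter_gt, sylvTree_filter_gt, h])]

theorem sylvTree_append_congr {u v u' v' : List α} (h : sylvTree u = sylvTree v)
    (h' : sylvTree u' = sylvTree v') : sylvTree (u ++ u') = sylvTree (v ++ v') := by
  have e : ∀ a b : List α, sylvTree (a ++ b) = a.foldr insertRightStrict (sylvTree b) :=
    fun a b => List.foldr_append
  rw [e, e, h']
  exact foldr_insert_congr _ _ _ h

/-- Relabel a tree and exchange left and right. -/
def mirrorMap {α β : Type*} (f : α → β) : BinaryTree α → BinaryTree β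
  | .nil => .nil
  | .node x l r => .node (f x) (mirrorMap f r) (mirrorMap f l)

theorem mirrorMap_injective {α β : Type*} {f : α → β} (hf : Function.Injective f) :
    Function.Injective (mirrorMap f) := by
  intro S
  induction S with
  | nil => intro T h; cases T with
    | nil => rfl
    | node y l r => simp [mirrorMap] at h
  | node x l r ihl ihr => intro T h; cases T with
    | nil => simp [mirrorMap] at h
    | node y l' r' =>
      simp only [mirrorMap, BinaryTree.node.injEq] at h
      rw [hf h.1, ihl h.2.2, ihr h.2.1]

theorem mirrorMap_insert {f : α → β} (hf : StrictAnti f) (a : α) (T : BinaryTree α) :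
    mirrorMap f (insertRightStrict a T) = insertLeftStrict (f a) (mirrorMap f T) := by
  induction T with
  | nil => rfl
  | node x l r ihl ihr =>
    by_cases h : x < a <;> simp [insertRightStrict, insertLeftStrict, mirrorMap, hf.lt_iff_gt, h,
      ihl, ihr]

theorem sylvSharpTree_reverse_map {f : α → β} (hf : StrictAnti f) (w : List α) :
    sylvSharpTree (w.map f).reverse = mirrorMap f (sylvTree w) := by
  unfold sylvSharpTree
  rw [List.foldl_reverse]
  induction w with
  | nil => rfl
  | cons a w ih =>
    have h : sylvTree (a :: w) = insertRightStrict a (sylvTree w) := rfl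
    rw [h, mirrorMap_insert hf, ← ih]
    rfl

theorem sylvSharpTree_eq_iff (u v : List α) :
    sylvSharpTree u = sylvSharpTree v ↔
      sylvTree (u.map OrderDual.toDual).reverse = sylvTree (v.map OrderDual.toDual).reverse := by
  have hf : StrictAnti (OrderDual.ofDual : αᵒᵈ → α) := fun _ _ h => h
  have e : ∀ w : List α,
      sylvSharpTree w = mirrorMap OrderDual.ofDual (sylvTree (w.map OrderDual.toDual).reverse) := by
    intro w
    rw [← sylvSharpTree_reverse_map hf]
    simp [Function.comp_def]
  rw [e u, e v]
  exact (mirrorMap_injective OrderDual.ofDual.injective).eq_iff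

theorem sylvSharpTree_append_congr {u v u' v' : List α} (h : sylvSharpTree u = sylvSharpTree v)
    (h' : sylvSharpTree u' = sylvSharpTree v') :
    sylvSharpTree (u ++ u') = sylvSharpTree (v ++ v') := by
  rw [sylvSharpTree_eq_iff] at *
  simp only [List.map_append, List.reverse_append]
  exact sylvTree_append_congr h' h

end Trees

/-! ### The Baxter monoid and the Schützenberger involution -/

/-- The relation "same pair of twin binary search trees" on words over the ordered alphabet
`Fin n` (that is, `1 < 2 < ⋯ < n`), as a monoid congruence. -/
def baxterCon (n : ℕ) : Con (FreeMonoid (Fin n)) where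
  r u v := baxterSymbol u.toList = baxterSymbol v.toList
  iseqv := ⟨fun _ => rfl, fun h => h.symm, fun h h' => h.trans h'⟩
  mul' := by
    intro u v u' v' h h'
    simp only [baxterSymbol, Prod.mk.injEq, FreeMonoid.toList_mul] at *
    exact ⟨sylvSharpTree_append_congr h.1 h'.1, sylvTree_append_congr h.2 h'.2⟩

/-- The Baxter monoid of rank `n`. -/
def BaxterMonoid (n : ℕ) : Type := (baxterCon n).Quotient

instance (n : ℕ) : Monoid (BaxterMonoid n) := inferInstanceAs (Monoid (baxterCon n).Quotient)

/-- `w₁ ⋯ wₖ ↦ wₖ♯ ⋯ w₁♯`, where `♯` is the order-reversing permutation of the alphabet. -/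
def sharpWord {n : ℕ} (w : FreeMonoid (Fin n)) : FreeMonoid (Fin n) :=
  FreeMonoid.ofList (w.toList.map Fin.rev).reverse

theorem sharpWord_sharpWord {n : ℕ} (w : FreeMonoid (Fin n)) : sharpWord (sharpWord w) = w := by
  simp [sharpWord, Function.comp_def]

theorem sharpWord_mul {n : ℕ} (u v : FreeMonoid (Fin n)) :
    sharpWord (u * v) = sharpWord v * sharpWord u := by
  simp [sharpWord]

theorem sharpWord_congr {n : ℕ} {u v : FreeMonoid (Fin n)} (h : baxterCon n u v) :
    baxterCon n (sharpWord u) (sharpWord v) := by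
  have hf : StrictAnti (Fin.rev : Fin n → Fin n) := Fin.rev_strictAnti
  have e : ∀ w : FreeMonoid (Fin n),
      sylvSharpTree (sharpWord w).toList = mirrorMap Fin.rev (sylvTree w.toList) :=
    fun w => sylvSharpTree_reverse_map hf w.toList
  have e' : ∀ w : FreeMonoid (Fin n),
      sylvSharpTree w.toList = mirrorMap Fin.rev (sylvTree (sharpWord w).toList) := by
    intro w
    rw [← e, sharpWord_sharpWord]
  have h1 : sylvSharpTree u.toList = sylvSharpTree v.toList := congrArg Prod.fst h
  have h2 : sylvTree u.toList = sylvTree v.toList := congrArg Prod.snd h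
  rw [e' u, e' v] at h1
  exact Prod.ext (by simp only [baxterSymbol, e, h2])
    (mirrorMap_injective Fin.rev_injective h1)

/-- The Schützenberger involution makes the Baxter monoid an involution monoid. -/
instance (n : ℕ) : StarMul (BaxterMonoid n) where
  star := Quotient.map sharpWord (fun _ _ h => sharpWord_congr h)
  star_involutive := by
    rintro ⟨w⟩
    exact congrArg (Quotient.mk _) (sharpWord_sharpWord w)
  star_mul := by
    rintro ⟨u⟩ ⟨v⟩
    exact congrArg (Quotient.mk _) (sharpWord_mul u v)

/-! ### Terms, identities and deduction -/

/-- Terms over the countably infinite alphabet `ℕ`; `one` is the empty term, `mul` is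
concatenation (taken up to associativity and the unit laws in `DirectlyDeducible`). -/
inductive Term : Type
  | var (i : ℕ) : Term
  | one : Term
  | mul (s t : Term) : Term
  | star (t : Term) : Term

/-- Apply a substitution of terms for variables. -/
def Term.subst (φ : ℕ → Term) : Term → Term
  | .var i => φ i
  | .one => .one
  | .mul s t => .mul (s.subst φ) (t.subst φ)
  | .star t => .star (t.subst φ)

/-- The value of a term in an involution monoid under a substitution. -/
def Term.eval {S : Type*} [Monoid S] [StarMul S] (φ : ℕ → S) : Term → S
  | .var i => φ i
  | .one => 1
  | .mul s t => s.eval φ * t.eval φ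
  | .star t => Star.star (t.eval φ)

/-- An identity `s ≈ t`, as a pair of terms. -/
abbrev Identity : Type := Term × Term

/-- The involution monoid `S` satisfies the identity `e`. -/
def Satisfies (S : Type*) [Monoid S] [StarMul S] (e : Identity) : Prop :=
  ∀ φ : ℕ → S, e.1.eval φ = e.2.eval φ

/-- One step of deduction from `E`: a subterm that is a substitution instance of the left side of
an identity in `E` is replaced by the same instance of the right side. As concatenation is
associative with the empty term as unit, rebracketing and deleting the unit are also steps. -/
inductive DirectlyDeducible (E : Set Identity) : Term → Term → Prop
  | inst (e : Identity) (he : e ∈ E) (φ : ℕ → Term) :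
      DirectlyDeducible E (e.1.subst φ) (e.2.subst φ)
  | assoc (r s t : Term) : DirectlyDeducible E (.mul (.mul r s) t) (.mul r (.mul s t))
  | one_mul (t : Term) : DirectlyDeducible E (.mul .one t) t
  | mul_one (t : Term) : DirectlyDeducible E (.mul t .one) t
  | mul_left (r : Term) {s t : Term} :
      DirectlyDeducible E s t → DirectlyDeducible E (.mul r s) (.mul r t)
  | mul_right (r : Term) {s t : Term} :
      DirectlyDeducible E s t → DirectlyDeducible E (.mul s r) (.mul t r)
  | star {s t : Term} :
      DirectlyDeducible E s t → DirectlyDeducible E (.star s) (.star t)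

/-- `e` is deducible from `E`: its sides are joined by a finite chain of direct deductions,
each used in either direction. -/
def Deducible (E : Set Identity) (e : Identity) : Prop :=
  Relation.EqvGen (DirectlyDeducible E) e.1 e.2

/-- `E` is an identity basis for `S`: it consists of identities of `S`, and every identity of `S`
is deducible from it. -/
def IsIdentityBasis (S : Type*) [Monoid S] [StarMul S] (E : Set Identity) : Prop :=
  (∀ e ∈ E, Satisfies S e) ∧ ∀ e : Identity, Satisfies S e → Deducible E e

/-- `S` has a finite identity basis. -/
def IsFinitelyBased (S : Type*) [Monoid S] [StarMul S] : Prop :=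
  ∃ E : Set Identity, E.Finite ∧ IsIdentityBasis S E

/-- The involution axioms `(x*)* ≈ x` and `(xy)* ≈ y* x*`. -/
def involutionAxioms : Set Identity :=
  {(.star (.star (.var 0)), .var 0),
   (.star (.mul (.var 0) (.var 1)), .mul (.star (.var 1)) (.star (.var 0)))}

/-! ### Word identities -/

/-- A letter: a variable `x` or a starred variable `x*`. -/
inductive Letter : Type
  | plain (i : ℕ) : Letter
  | starred (i : ℕ) : Letter

/-- The term given by a letter. -/
def Letter.toTerm : Letter → Term
  | .plain i => .var i
  | .starred i => .star (.var i)

/-- The term given by a word. -/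
def wordTerm (w : List Letter) : Term := (w.map Letter.toTerm).foldr .mul .one

/-- The identity given by a pair of words. -/
def wordIdentity (p : List Letter × List Letter) : Identity := (wordTerm p.1, wordTerm p.2)

/-- The reverse of a word identity (letters keep their stars). -/
def reverseIdentity (p : List Letter × List Letter) : List Letter × List Letter :=
  (p.1.reverse, p.2.reverse)

/-- The variable `x`. -/
def x : Letter := .plain 0
/-- The starred variable `x*`. -/
def x' : Letter := .starred 0
/-- The variable `y`. -/
def y : Letter := .plain 1
/-- The starred variable `y*`. -/
def y' : Letter := .starred 1
/-- The variable `h`. -/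
def h : Letter := .plain 2
/-- The variable `k`. -/
def k : Letter := .plain 3
/-- The variable `s`. -/
def s : Letter := .plain 4
/-- The variable `t`. -/
def t : Letter := .plain 5

/-- The seven groups of word identities. -/
def baxterTwoIdentities : List (List Letter × List Letter) :=
  [ -- first group
   ([x', h, x, k, x, y, s, x', t, x], [x', h, x, k, y, x, s, x', t, x]),
   ([x', h, x, k, x, y, s, x, t, x'], [x', h, x, k, y, x, s, x, t, x']),
   ([x, h, x', k, x, y, s, x', t, x], [x, h, x', k, y, x, s, x', t, x]),
   ([x, h, x', k, x, y, s, x, t, x'], [x, h, x', k, y, x, s, x, t, x']),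
   -- second group
   ([x', h, x, k, x, y, s, y', t, y], [x', h, x, k, y, x, s, y', t, y]),
   ([x', h, x, k, x, y, s, y, t, y'], [x', h, x, k, y, x, s, y, t, y']),
   ([x, h, x', k, x, y, s, y', t, y], [x, h, x', k, y, x, s, y', t, y]),
   ([x, h, x', k, x, y, s, y, t, y'], [x, h, x', k, y, x, s, y, t, y']),
   -- third group
   ([x, h, y, k, x, y, s, x, t, y], [x, h, y, k, y, x, s, x, t, y]),
   ([x, h, y, k, x, y, s, y, t, x], [x, h, y, k, y, x, s, y, t, x]),
   -- fourth group
   ([x, h, y, k, x, y, s, x', t, y'], [x, h, y, k, y, x, s, x', t, y']),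
   ([x, h, y, k, x, y, s, y', t, x'], [x, h, y, k, y, x, s, y', t, x']),
   -- fifth group
   ([x', h, y', k, x, y, s, x', t, y'], [x', h, y', k, y, x, s, x', t, y']),
   ([x', h, y', k, x, y, s, y', t, x'], [x', h, y', k, y, x, s, y', t, x']),
   -- sixth group
   ([x', h, x, k, x, y, s, x, t, y], [x', h, x, k, y, x, s, x, t, y]),
   ([x', h, x, k, x, y, s, y, t, x], [x', h, x, k, y, x, s, y, t, x]),
   ([x, h, x', k, x, y, s, x, t, y], [x, h, x', k, y, x, s, x, t, y]),
   ([x, h, x', k, x, y, s, y, t, x], [x, h, x', k, y, x, s, y, t, x]),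
   -- seventh group
   ([x', h, x, k, x, y, s, x', t, y'], [x', h, x, k, y, x, s, x', t, y']),
   ([x', h, x, k, x, y, s, y', t, x'], [x', h, x, k, y, x, s, y', t, x']),
   ([x, h, x', k, x, y, s, x', t, y'], [x, h, x', k, y, x, s, x', t, y']),
   ([x, h, x', k, x, y, s, y', t, x'], [x, h, x', k, y, x, s, y', t, x'])]

/-- The involution axioms, the seven groups of word identities, and the reverses of the latter. -/
def baxterTwoBasis : Set Identity :=
  involutionAxioms ∪ {e | ∃ p ∈ baxterTwoIdentities, e = wordIdentity p} ∪
    {e | ∃ p ∈ baxterTwoIdentities, e = wordIdentity (reverseIdentity p)}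

end BaxterInvolution

namespace BaxterInvolution

/-! ### Twin trees over a two-letter alphabet -/

/-! Over a two-letter alphabet the pair of trees of a word records exactly its content, the length
of its initial run of 0s and the length of its final run of 1s (`baxterSymbol_eq_iff`). Everything
reduces to these statistics and to exchanging adjacent letters.

Soundness: exchanging `a`, `b` between `p` and `q` preserves the content. If the value of `p`
contains a 1, it already fixes the initial run of 0s; otherwise that value is a power of 0, and when
`p` is `Separating` this forces the values of `a` and `b` to commute. The final run of 1s is the
image of the initial run of 0s under the involution, so it is controlled by `q` in the same way
(`wordHolds_swap`).

Completeness: substituting a power of 0 for `a` and 1 for `e` shows that a valid identity preserves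
the number of `a` before the first `a*` or `e` (`WordHolds.countBefore_eq`). These invariants force
both contexts to be separating whenever two adjacent letters of `v` must be exchanged to approach
`u` (`WordHolds.separating_left`, `WordHolds.separating_right`). Hence `v` can be sorted into `u`,
one letter at a time, by sound exchanges. Each exchange is an instance of a basis identity, because
a separating context contains one of eight ordered pairs on each side and the basis covers all 64
combinations up to renaming (`contextIdentity_eq_rename`). The involution axioms reduce arbitrary
terms to words. -/

/-- The length of the longest prefix of `w` consisting of occurrences of `c`. -/
def leadCount {α : Type*} [DecidableEq α] (c : α) (w : List α) : ℕ :=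
  (w.takeWhile (· = c)).length

theorem numNodes_insertRightStrict {α : Type*} [LinearOrder α] (a : α) (T : BinaryTree α) :
    (insertRightStrict a T).numNodes = T.numNodes + 1 := by
  induction T with
  | nil => rfl
  | node b l r ihl ihr =>
    unfold insertRightStrict
    split <;> simp only [BinaryTree.numNodes, ihl, ihr] <;> omega

theorem numNodes_sylvTree {α : Type*} [LinearOrder α] (w : List α) :
    (sylvTree w).numNodes = w.length := by
  induction w with
  | nil => rfl
  | cons a w ih =>
    have e : sylvTree (a :: w) = insertRightStrict a (sylvTree w) := rfl
    rw [e, numNodes_insertRightStrict, ih, List.length_cons]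

theorem sylvTree_concat {α : Type*} [LinearOrder α] (w : List α) (a : α) :
    sylvTree (w ++ [a]) = .node a (sylvTree (w.filter (fun b => ¬ a < b)))
      (sylvTree (w.filter (fun b => a < b))) := by
  have e : sylvTree (w ++ [a]) = w.foldr insertRightStrict (.node a .nil .nil) := by
    simp [sylvTree, insertRightStrict]
  rw [e, foldr_insert_node]
  rfl

theorem filter_fin_two_eq_replicate (c : Fin 2) (p : Fin 2 → Bool) (hp : ∀ b, p b = true ↔ b = c)
    (w : List (Fin 2)) : w.filter p = List.replicate (w.count c) c := by
  have : p = fun b => b == c := by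
    funext b
    rw [Bool.eq_iff_iff, hp]
    simp
  rw [this, List.filter_beq]

theorem sylvTree_concat_zero (w : List (Fin 2)) :
    sylvTree (w ++ [0]) = .node 0 (sylvTree (List.replicate (w.count 0) 0))
      (sylvTree (List.replicate (w.count 1) 1)) := by
  rw [sylvTree_concat, filter_fin_two_eq_replicate 0 _ (by decide),
    filter_fin_two_eq_replicate 1 _ (by decide)]

theorem sylvTree_concat_one (w : List (Fin 2)) :
    sylvTree (w ++ [1]) = .node 1 (sylvTree w) .nil := by
  have le_one (b : Fin 2) : ¬ 1 < b := by omega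
  rw [sylvTree_concat, List.filter_eq_self.2 (by simp [le_one]),
    List.filter_eq_nil_iff.2 (by simp [le_one])]
  rfl

theorem sylvTree_replicate_inj {c : Fin 2} {m n : ℕ} :
    sylvTree (List.replicate m c) = sylvTree (List.replicate n c) ↔ m = n := by
  refine ⟨fun e => ?_, fun e => by rw [e]⟩
  have := congrArg BinaryTree.numNodes e
  simpa [numNodes_sylvTree] using this

/-- The first letter of `u` is the root. A root 0 sends the remaining 0s left and the 1s right, so
only the counts survive; a root 1 sends everything left, and the comparison recurses until the first
0. -/
theorem sylvTree_reverse_eq_iff (u v : List (Fin 2)) :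
    sylvTree u.reverse = sylvTree v.reverse ↔
      u.count 0 = v.count 0 ∧ u.count 1 = v.count 1 ∧ leadCount 1 u = leadCount 1 v := by
  induction u generalizing v with
  | nil =>
    rcases v with _ | ⟨b, v⟩
    · simp
    · refine iff_of_false (fun e => ?_) ?_
      · have := congrArg BinaryTree.numNodes e
        simp [numNodes_sylvTree] at this
      · rintro ⟨e0, e1, -⟩
        obtain rfl | rfl : b = 0 ∨ b = 1 := by omega
        · simp at e0
        · simp at e1
  | cons a u ih =>
    rcases v with _ | ⟨b, v⟩
    · refine iff_of_false (fun e => ?_) ?_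
      · have := congrArg BinaryTree.numNodes e
        simp [numNodes_sylvTree] at this
      · rintro ⟨e0, e1, -⟩
        obtain rfl | rfl : a = 0 ∨ a = 1 := by omega
        · simp at e0
        · simp at e1
    · rw [List.reverse_cons, List.reverse_cons]
      obtain rfl | rfl : a = 0 ∨ a = 1 := by omega
      · obtain rfl | rfl : b = 0 ∨ b = 1 := by omega
        · rw [sylvTree_concat_zero, sylvTree_concat_zero]
          simp [sylvTree_replicate_inj, leadCount]
        · rw [sylvTree_concat_zero, sylvTree_concat_one]
          simp [leadCount]
      · obtain rfl | rfl : b = 0 ∨ b = 1 := by omega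
        · rw [sylvTree_concat_zero, sylvTree_concat_one]
          simp [leadCount]
        · rw [sylvTree_concat_one, sylvTree_concat_one]
          simp [leadCount, ih]

/-- The involution on words over the two-letter alphabet. -/
def sharpList (w : List (Fin 2)) : List (Fin 2) := (w.map Fin.rev).reverse

theorem sharpList_append (u v : List (Fin 2)) :
    sharpList (u ++ v) = sharpList v ++ sharpList u := by simp [sharpList]

@[simp]
theorem sharpList_sharpList (w : List (Fin 2)) : sharpList (sharpList w) = w := by
  simp [sharpList, Function.comp_def]

theorem mem_sharpList {w : List (Fin 2)} {c : Fin 2} : c ∈ sharpList w ↔ c.rev ∈ w := by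
  simp only [sharpList, List.mem_reverse, List.mem_map]
  exact ⟨by rintro ⟨b, hb, rfl⟩; simpa using hb, fun hb => ⟨_, hb, by simp⟩⟩

theorem leadCount_map_rev (c : Fin 2) (w : List (Fin 2)) :
    leadCount c (w.map Fin.rev) = leadCount c.rev w := by
  simp [leadCount, List.takeWhile_map, Function.comp_def, Fin.rev_eq_iff]

theorem count_map_rev (c : Fin 2) (w : List (Fin 2)) :
    (w.map Fin.rev).count c = w.count c.rev := by
  rw [← List.count_map_of_injective w Fin.rev Fin.rev_injective c.rev, Fin.rev_rev]

theorem sylvSharpTree_eq_iff_sharpList (u v : List (Fin 2)) :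
    sylvSharpTree u = sylvSharpTree v ↔ sylvTree (sharpList u) = sylvTree (sharpList v) := by
  have e (w : List (Fin 2)) : sylvSharpTree w = mirrorMap Fin.rev (sylvTree (sharpList w)) := by
    rw [← sylvSharpTree_reverse_map Fin.rev_strictAnti]
    exact congrArg sylvSharpTree (sharpList_sharpList w).symm
  rw [e u, e v]
  exact (mirrorMap_injective Fin.rev_injective).eq_iff

theorem perm_iff_count_fin_two (u v : List (Fin 2)) :
    u.Perm v ↔ u.count 0 = v.count 0 ∧ u.count 1 = v.count 1 := by
  rw [List.perm_iff_count, Fin.forall_fin_two]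

/-- The two run lengths are the initial 0s and, through `sharpList`, the final 1s. In this form the
involution merely exchanges the two conditions. -/
theorem baxterSymbol_eq_iff (u v : List (Fin 2)) :
    baxterSymbol u = baxterSymbol v ↔
      u.Perm v ∧ leadCount 0 u = leadCount 0 v ∧
        leadCount 0 (sharpList u) = leadCount 0 (sharpList v) := by
  have e1 : sylvSharpTree u = sylvSharpTree v ↔
      u.count 0 = v.count 0 ∧ u.count 1 = v.count 1 ∧ leadCount 0 u = leadCount 0 v := by
    rw [sylvSharpTree_eq_iff_sharpList, sharpList, sharpList, sylvTree_reverse_eq_iff]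
    simp only [count_map_rev, leadCount_map_rev]
    exact ⟨fun ⟨a, b, c⟩ => ⟨b, a, c⟩, fun ⟨a, b, c⟩ => ⟨b, a, c⟩⟩
  have e2 : sylvTree u = sylvTree v ↔ u.count 0 = v.count 0 ∧ u.count 1 = v.count 1 ∧
      leadCount 0 (sharpList u) = leadCount 0 (sharpList v) := by
    have := sylvTree_reverse_eq_iff u.reverse v.reverse
    rw [List.reverse_reverse, List.reverse_reverse, List.count_reverse, List.count_reverse,
      List.count_reverse, List.count_reverse] at this
    rw [this, sharpList, sharpList, ← List.map_reverse, ← List.map_reverse, leadCount_map_rev,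
      leadCount_map_rev]
    rfl
  rw [baxterSymbol, baxterSymbol, Prod.mk.injEq, e1, e2, perm_iff_count_fin_two]
  tauto

/-! ### Letters and words -/

namespace Letter

instance : DecidableEq Letter
  | .plain i, .plain j => decidable_of_iff (i = j) (by simp)
  | .starred i, .starred j => decidable_of_iff (i = j) (by simp)
  | .plain _, .starred _ => isFalse (by simp)
  | .starred _, .plain _ => isFalse (by simp)

/-- The involution on letters. -/
def inv : Letter → Letter
  | .plain i => .starred i
  | .starred i => .plain i

@[simp]
theorem inv_inv (a : Letter) : a.inv.inv = a := by cases a <;> rfl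

theorem inv_injective : Function.Injective inv :=
  Function.LeftInverse.injective inv_inv

@[simp]
theorem inv_inj {a b : Letter} : a.inv = b.inv ↔ a = b := inv_injective.eq_iff

@[simp]
theorem inv_ne_self (a : Letter) : a.inv ≠ a := by cases a <;> simp [inv]

@[simp]
theorem ne_inv_self (a : Letter) : a ≠ a.inv := (inv_ne_self a).symm

end Letter

/-- The formal involution on words. -/
def barWord (w : List Letter) : List Letter := (w.map Letter.inv).reverse

@[simp]
theorem barWord_append (u v : List Letter) : barWord (u ++ v) = barWord v ++ barWord u := by
  simp [barWord]

theorem barWord_cons (a : Letter) (w : List Letter) :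
    barWord (a :: w) = barWord w ++ [a.inv] := by
  simp [barWord]

@[simp]
theorem barWord_barWord (w : List Letter) : barWord (barWord w) = w := by
  simp [barWord, Function.comp_def]

@[simp]
theorem mem_barWord {w : List Letter} {a : Letter} : a ∈ barWord w ↔ a.inv ∈ w := by
  simp only [barWord, List.mem_reverse, List.mem_map]
  exact ⟨by rintro ⟨b, hb, rfl⟩; simpa using hb, fun hb => ⟨_, hb, by simp⟩⟩

theorem count_barWord (w : List Letter) (a : Letter) : (barWord w).count a = w.count a.inv := by
  rw [barWord, List.count_reverse, ← List.count_map_of_injective w _ Letter.inv_injective a.inv,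
    Letter.inv_inv]

/-- The value of a letter under a substitution of two-letter words for variables. -/
def letterValue (ω : ℕ → List (Fin 2)) : Letter → List (Fin 2)
  | .plain i => ω i
  | .starred i => sharpList (ω i)

/-- The value of a word under a substitution of two-letter words for variables. -/
def wordValue (ω : ℕ → List (Fin 2)) (w : List Letter) : List (Fin 2) :=
  w.flatMap (letterValue ω)

theorem letterValue_inv (ω : ℕ → List (Fin 2)) (a : Letter) :
    letterValue ω a.inv = sharpList (letterValue ω a) := by
  cases a <;> simp [letterValue, Letter.inv]

@[simp]
theorem wordValue_append (ω : ℕ → List (Fin 2)) (u v : List Letter) :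
    wordValue ω (u ++ v) = wordValue ω u ++ wordValue ω v := List.flatMap_append

@[simp]
theorem wordValue_cons (ω : ℕ → List (Fin 2)) (a : Letter) (u : List Letter) :
    wordValue ω (a :: u) = letterValue ω a ++ wordValue ω u := rfl

@[simp]
theorem wordValue_nil (ω : ℕ → List (Fin 2)) : wordValue ω [] = [] := rfl

theorem wordValue_barWord (ω : ℕ → List (Fin 2)) (w : List Letter) :
    wordValue ω (barWord w) = sharpList (wordValue ω w) := by
  induction w with
  | nil => rfl
  | cons a w ih =>
    rw [barWord_cons, wordValue_append, ih, wordValue_cons, wordValue_cons, sharpList_append,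
      letterValue_inv]
    simp

/-! ### Word identities of the Baxter monoid of rank two -/

/-- The two words have the same value in the Baxter monoid of rank two under every substitution. -/
def WordHolds (u v : List Letter) : Prop :=
  ∀ ω, baxterSymbol (wordValue ω u) = baxterSymbol (wordValue ω v)

theorem WordHolds.trans {u v w : List Letter} (e : WordHolds u v) (e' : WordHolds v w) :
    WordHolds u w := fun ω => (e ω).trans (e' ω)

theorem WordHolds.bar {u v : List Letter} (e : WordHolds u v) :
    WordHolds (barWord u) (barWord v) := by
  intro ω
  have := e ω
  rw [baxterSymbol_eq_iff] at this ⊢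
  rw [wordValue_barWord, wordValue_barWord, sharpList_sharpList, sharpList_sharpList]
  refine ⟨?_, this.2.2, this.2.1⟩
  exact (List.reverse_perm _).trans ((this.1.map _).trans (List.reverse_perm _).symm)

/-- The element of the Baxter monoid represented by a word. -/
def toBaxter (w : List (Fin 2)) : BaxterMonoid 2 :=
  Quotient.mk (baxterCon 2).toSetoid (FreeMonoid.ofList w)

theorem toBaxter_surjective : Function.Surjective toBaxter := by
  rintro ⟨w⟩
  exact ⟨w.toList, rfl⟩

theorem toBaxter_eq_iff {u v : List (Fin 2)} :
    toBaxter u = toBaxter v ↔ baxterSymbol u = baxterSymbol v :=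
  Quotient.eq

theorem toBaxter_append (u v : List (Fin 2)) : toBaxter (u ++ v) = toBaxter u * toBaxter v := rfl

theorem toBaxter_nil : toBaxter [] = 1 := rfl

theorem eval_wordTerm (ω : ℕ → List (Fin 2)) (w : List Letter) :
    (wordTerm w).eval (fun i => toBaxter (ω i)) = toBaxter (wordValue ω w) := by
  induction w with
  | nil => exact toBaxter_nil.symm
  | cons a w ih =>
    rw [wordValue_cons, toBaxter_append, ← ih]
    cases a <;> rfl

/-- Every substitution into the monoid lifts to a choice of representing words, so satisfaction can
be tested on words over the two-letter alphabet. -/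
theorem satisfies_wordIdentity_iff (p : List Letter × List Letter) :
    Satisfies (BaxterMonoid 2) (wordIdentity p) ↔ WordHolds p.1 p.2 := by
  constructor
  · intro e ω
    have := e (fun i => toBaxter (ω i))
    simpa only [wordIdentity, eval_wordTerm, toBaxter_eq_iff] using this
  · intro e φ
    obtain ⟨ω, hω⟩ : ∃ ω : ℕ → List (Fin 2), (fun i => toBaxter (ω i)) = φ :=
      ⟨fun i => (toBaxter_surjective (φ i)).choose,
        funext fun i => (toBaxter_surjective (φ i)).choose_spec⟩
    rw [← hω]
    simpa only [wordIdentity, eval_wordTerm, toBaxter_eq_iff] using e ω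

/-! ### Separating contexts and soundness of exchanges -/

/-- The word `w` contains both members of one of the pairs `a, a*`, `b, b*`, `a, b`, `a*, b*`. -/
def Separating (a b : Letter) (w : List Letter) : Prop :=
  (a ∈ w ∧ a.inv ∈ w) ∨ (b ∈ w ∧ b.inv ∈ w) ∨ (a ∈ w ∧ b ∈ w) ∨ (a.inv ∈ w ∧ b.inv ∈ w)

instance (a b : Letter) (w : List Letter) : Decidable (Separating a b w) :=
  inferInstanceAs (Decidable (_ ∨ _))

theorem Separating.bar {a b : Letter} {w : List Letter} (hw : Separating a b w) :
    Separating b.inv a.inv (barWord w) := by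
  simp only [Separating, mem_barWord, Letter.inv_inv] at hw ⊢
  tauto

theorem leadCount_append_of_mem {c d : Fin 2} (hcd : d ≠ c) {u : List (Fin 2)} (hu : d ∈ u)
    (v : List (Fin 2)) : leadCount c (u ++ v) = leadCount c u := by
  induction u with
  | nil => simp at hu
  | cons b u ih =>
    by_cases hb : b = c
    · subst hb
      have hd : d ∈ u := by simpa [hcd] using hu
      simp only [leadCount, List.cons_append, List.takeWhile_cons, decide_true, if_true,
        List.length_cons] at ih ⊢
      rw [ih hd]
    · simp [leadCount, hb]

/-- Every letter of `w` takes a power of 0 as value, and every letter whose inverse is in `w` a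
power of 1. A pair `a, a*` (or `b, b*`) therefore makes a value empty, while a pair `a, b` or `a*,
b*` makes both values powers of one generator. -/
theorem append_comm_of_separating {ω : ℕ → List (Fin 2)} {a b : Letter} {w : List Letter}
    (hw : Separating a b w) (h1 : 1 ∉ wordValue ω w) :
    letterValue ω a ++ letterValue ω b = letterValue ω b ++ letterValue ω a := by
  have key (l : Letter) (hl : l ∈ w) : 1 ∉ letterValue ω l := fun h =>
    h1 (List.mem_flatMap.2 ⟨l, hl, h⟩)
  have key' (l : Letter) (hl : l.inv ∈ w) : 0 ∉ letterValue ω l := fun h => by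
    refine key _ hl ?_
    rw [letterValue_inv, mem_sharpList]
    exact h
  have rep (c d : Fin 2) (hcd : ∀ e, e = c ∨ e = d) (l : List (Fin 2)) (hl : d ∉ l) :
      l = List.replicate l.length c :=
    List.eq_replicate_iff.2 ⟨rfl, fun e he => (hcd e).resolve_right fun h => hl (h ▸ he)⟩
  have emp (l : List (Fin 2)) (h1 : 1 ∉ l) (h0 : 0 ∉ l) : l = [] :=
    List.eq_nil_iff_forall_not_mem.2 fun e => by
      obtain rfl | rfl : e = 0 ∨ e = 1 := by omega
      · exact h0
      · exact h1
  rcases hw with ⟨h, h'⟩ | ⟨h, h'⟩ | ⟨h, h'⟩ | ⟨h, h'⟩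
  · simp [emp _ (key _ h) (key' _ h')]
  · simp [emp _ (key _ h) (key' _ h')]
  · rw [rep 0 1 (by decide) _ (key _ h), rep 0 1 (by decide) _ (key _ h')]
    simp [Nat.add_comm]
  · rw [rep 1 0 (by decide) _ (key' _ h), rep 1 0 (by decide) _ (key' _ h')]
    simp [Nat.add_comm]

theorem leadCount_swap {a b : Letter} {p : List Letter} (hp : Separating a b p) (q : List Letter)
    (ω : ℕ → List (Fin 2)) :
    leadCount 0 (wordValue ω (p ++ [a, b] ++ q)) = leadCount 0 (wordValue ω (p ++ [b, a] ++ q)) := by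
  simp only [List.append_assoc, wordValue_append]
  by_cases h1 : 1 ∈ wordValue ω p
  · rw [leadCount_append_of_mem (by decide) h1, leadCount_append_of_mem (by decide) h1]
  · have := append_comm_of_separating hp h1
    simp only [wordValue_cons, wordValue_nil, List.append_nil, this]

/-- Adjacent letters may be exchanged in a separating context. -/
theorem wordHolds_swap {a b : Letter} {p q : List Letter} (hp : Separating a b p)
    (hq : Separating a b q) : WordHolds (p ++ [a, b] ++ q) (p ++ [b, a] ++ q) := by
  intro ω
  rw [baxterSymbol_eq_iff]
  refine ⟨?_, leadCount_swap hp q ω, ?_⟩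
  · simp only [wordValue_append, wordValue_cons, wordValue_nil, List.append_nil]
    exact (List.perm_append_comm.append_left _).append_right _
  -- The final 1s are the initial 0s of the barred words, where the barred right context stands on
  -- the left.
  · rw [← wordValue_barWord, ← wordValue_barWord]
    simpa [barWord] using leadCount_swap hq.bar (barWord p) ω

/-! ### Invariants of word identities -/

/-- The number of occurrences of `a` in `w` before the first occurrence of `a*` or `e`. -/
def countBefore (a e : Letter) (w : List Letter) : ℕ :=
  (w.takeWhile (fun l => l ≠ a.inv ∧ l ≠ e)).count a

theorem countBefore_cons (a e l : Letter) (w : List Letter) :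
    countBefore a e (l :: w) =
      if l ≠ a.inv ∧ l ≠ e then countBefore a e w + (if l = a then 1 else 0) else 0 := by
  unfold countBefore
  rw [List.takeWhile_cons]
  by_cases hl : l ≠ a.inv ∧ l ≠ e
  · simp [hl, List.count_cons]
  · simp [hl]

theorem countBefore_append_of_notMem {a e : Letter} {u : List Letter} (ha : a.inv ∉ u) (he : e ∉ u)
    (v : List Letter) : countBefore a e (u ++ v) = u.count a + countBefore a e v := by
  unfold countBefore
  rw [List.takeWhile_append_of_pos, List.count_append]
  intro l hl
  simpa using ⟨fun h => ha (h ▸ hl), fun h => he (h ▸ hl)⟩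

theorem countBefore_append_le {a e l : Letter} {u : List Letter} (hl : l ∈ u)
    (h : l = a.inv ∨ l = e) (v : List Letter) : countBefore a e (u ++ v) ≤ u.count a := by
  induction u with
  | nil => simp at hl
  | cons b u ih =>
    rw [List.cons_append, countBefore_cons, List.count_cons]
    by_cases hb : b ≠ a.inv ∧ b ≠ e
    · have hlu : l ∈ u := by
        rcases List.mem_cons.1 hl with rfl | hl
        · tauto
        · exact hl
      rw [if_pos hb]
      have := ih hlu
      by_cases hba : b = a <;> simpa [hba] using this
    · simp [hb]

/-! ### Test substitutions -/

/-- The substitution sending `a` to `0 ^ m`, then `e` to `1`, and the other variables to `1`. -/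
def testSubst (m : ℕ) (a e : Letter) (i : ℕ) : List (Fin 2) :=
  if .plain i = a then List.replicate m 0
  else if .starred i = a then List.replicate m 1
  else if .plain i = e then [1]
  else if .starred i = e then [0]
  else []

theorem sharpList_replicate (m : ℕ) (c : Fin 2) :
    sharpList (List.replicate m c) = List.replicate m c.rev := by
  simp [sharpList]

theorem letterValue_testSubst (m : ℕ) (a e l : Letter) (hae : e ≠ a) :
    letterValue (testSubst m a e) l =
      if l = a then List.replicate m 0
      else if l = a.inv then List.replicate m 1
      else if l = e then [1]
      else if l = e.inv then [0]
      else [] := by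
  have s0 : sharpList [0] = [1] := rfl
  have s1 : sharpList [1] = [0] := rfl
  have s2 : sharpList [] = [] := rfl
  rcases l with i | i <;> rcases a with j | j <;> rcases e with k | k <;>
    simp only [letterValue, testSubst, Letter.inv, reduceCtorEq, if_false, Letter.plain.injEq,
      Letter.starred.injEq] at hae ⊢ <;>
    split_ifs <;> simp_all [sharpList_replicate]

/-- The run of 0s ends at the first `a*` or `e`. Up to there each `a` contributes `m`, and each `e*`
different from `a` contributes 1. For `m = 0` the letter `a*` would vanish and not stop the run. -/
theorem leadCount_testSubst (m : ℕ) (hm : m ≠ 0) {a e : Letter} (hae : e ≠ a) (w : List Letter) :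
    leadCount 0 (wordValue (testSubst m a e) w) = m * countBefore a e w +
      (w.takeWhile (fun l => l ≠ a.inv ∧ l ≠ e)).countP (fun l => l ≠ a ∧ l = e.inv) := by
  induction w with
  | nil => simp [leadCount, countBefore]
  | cons l w ih =>
    rw [wordValue_cons, letterValue_testSubst m a e l hae, countBefore_cons, List.takeWhile_cons]
    by_cases h1 : l = a
    · subst h1
      have : leadCount 0 (List.replicate m 0 ++ wordValue (testSubst m l e) w) =
          m + leadCount 0 (wordValue (testSubst m l e) w) := by
        unfold leadCount
        rw [List.takeWhile_append_of_pos (by simp)]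
        simp
      simp [this, ih, hae.symm]
      ring
    · by_cases h2 : l = a.inv
      · obtain ⟨n, rfl⟩ := Nat.exists_eq_succ_of_ne_zero hm
        simp [h2, leadCount, List.replicate_succ]
      · by_cases h3 : l = e
        · simp [h3, hae, h3 ▸ h2, leadCount]
        · by_cases h4 : l = e.inv
          · subst h4
            have : leadCount 0 ([0] ++ wordValue (testSubst m a e) w) =
              leadCount 0 (wordValue (testSubst m a e) w) + 1 := by simp [leadCount]
            rw [if_neg h1, if_neg h2, if_neg h3, if_pos rfl, if_pos ⟨h2, h3⟩, if_neg h1,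
              if_pos (by simpa using h2), this, ih, List.countP_cons_of_pos (by simpa using h1)]
            ring
          · simp [h1, h2, h3, h4, ih]

theorem WordHolds.countBefore_eq {u v : List Letter} (huv : WordHolds u v) {a e : Letter}
    (hae : e ≠ a) : countBefore a e u = countBefore a e v := by
  -- Comparing `m = 1` with `m = 2` eliminates the contribution of `e*`, which does not depend on
  -- `m`.
  have e1 := ((baxterSymbol_eq_iff _ _).1 (huv (testSubst 1 a e))).2.1
  have e2 := ((baxterSymbol_eq_iff _ _).1 (huv (testSubst 2 a e))).2.1
  rw [leadCount_testSubst _ (by decide) hae, leadCount_testSubst _ (by decide) hae] at e1 e2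
  omega

theorem count_testSubst (a : Letter) (w : List Letter) :
    (wordValue (testSubst 1 a a.inv) w).count 0 = w.count a := by
  induction w with
  | nil => rfl
  | cons l w ih =>
    rw [wordValue_cons, letterValue_testSubst _ _ _ _ (Letter.inv_ne_self a), List.count_append, ih,
      List.count_cons, Letter.inv_inv]
    by_cases h1 : l = a
    · simp [h1, Nat.add_comm]
    · by_cases h2 : l = a.inv
      · simp [h2]
      · simp [h1, h2]

theorem WordHolds.count_eq {u v : List Letter} (huv : WordHolds u v) (a : Letter) :
    u.count a = v.count a := by
  rw [← count_testSubst, ← count_testSubst]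
  exact ((baxterSymbol_eq_iff _ _).1 (huv _)).1.count_eq 0

/-- Adjacent letters of `v` occurring in the other order in `u` have a separating left context. -/
theorem WordHolds.separating_left {u₁ u₂ p q : List Letter} {a c : Letter} (hca : c ≠ a)
    (huv : WordHolds (u₁ ++ a :: u₂) (p ++ c :: a :: q)) (ha : u₁.count a = p.count a)
    (hc : u₁.count c ≤ p.count c) : Separating c a p := by
  by_contra hs
  -- The four separating pairs are the edges of the 4-cycle `c, c*, a*, a`; an edge-free set of
  -- letters lies in one of the two diagonals `{c*, a}` and `{c, a*}`.
  have hcases : (a.inv ∉ p ∧ c ∉ p) ∨ (a ∉ p ∧ c.inv ∉ p) := by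
    unfold Separating at hs
    tauto
  rcases hcases with ⟨h1, h2⟩ | ⟨h1, h2⟩
  · have hcu : c ∉ u₁ := by
      rw [← List.count_eq_zero] at h2 ⊢
      omega
    -- If `a*` is in `u₁`, then `u` has at most `u₁.count a` letters `a` before the first `a*`,
    -- whereas `v` has at least one more.
    by_cases hau : a.inv ∈ u₁
    · have hca' : c ≠ a.inv := fun h => hcu (h ▸ hau)
      have e1 := huv.countBefore_eq (Letter.inv_ne_self a)
      have e2 := countBefore_append_le (e := a.inv) hau (.inl rfl) (a :: u₂)
      rw [countBefore_append_of_notMem h1 h1, countBefore_cons, countBefore_cons] at e1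
      simp only [hca', hca, Letter.ne_inv_self, ne_eq, not_false_eq_true, and_self, if_true,
        if_false] at e1
      omega
    -- Before the first `c`, the word `v` has exactly `p.count a` letters `a`, and `u` has at least
    -- one more.
    · have e1 := huv.countBefore_eq hca
      rw [countBefore_append_of_notMem h1 h2, countBefore_append_of_notMem hau hcu,
        countBefore_cons, countBefore_cons] at e1
      simp [hca.symm] at e1
      omega
  -- Here `c` is counted up to the first `c*` or `a`: `v` reaches `p.count c + 1`, while `u` is
  -- stopped by the displayed `a` at no more than `u₁.count c`.
  · have e1 := huv.countBefore_eq hca.symm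
    have e2 := countBefore_append_le (a := c) (e := a) (u := u₁ ++ [a]) (l := a) (by simp)
      (.inr rfl) u₂
    rw [countBefore_append_of_notMem h2 h1, countBefore_cons, countBefore_cons] at e1
    simp [hca, hca.symm] at e1 e2
    omega

theorem exists_eq_append_of_lt_count {w : List Letter} {c : Letter} {n : ℕ} (hn : n < w.count c) :
    ∃ w₁ w₂, w = w₁ ++ c :: w₂ ∧ w₂.count c = n := by
  induction w with
  | nil => simp at hn
  | cons b w ih =>
    by_cases h : n < w.count c
    · obtain ⟨w₁, w₂, rfl, h2⟩ := ih h
      exact ⟨b :: w₁, w₂, rfl, h2⟩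
    · rw [List.count_cons] at hn
      by_cases hb : b = c
      · subst hb
        simp at hn
        exact ⟨[], w, rfl, by omega⟩
      · simp [hb] at hn
        omega

/-- Adjacent letters of `v` occurring in the other order in `u` have a separating right context. -/
theorem WordHolds.separating_right {u₁ u₂ p q : List Letter} {a c : Letter} (hca : c ≠ a)
    (huv : WordHolds (u₁ ++ a :: u₂) (p ++ c :: a :: q)) (ha : u₁.count a = p.count a)
    (hc : u₁.count c ≤ p.count c) : Separating c a q := by
  have ca := huv.count_eq a
  have cc := huv.count_eq c
  simp [hca, hca.symm] at ca cc
  -- This picks the occurrence of `c` in `u` that has as many `c` after it as the displayed one in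
  -- `v`; by the count hypotheses it lies to the right of the displayed `a`.
  obtain ⟨w₁, w₂, rfl, hw⟩ : ∃ w₁ w₂, u₂ = w₁ ++ c :: w₂ ∧ w₂.count c = q.count c :=
    exists_eq_append_of_lt_count (by omega)
  have := huv.bar
  simp only [barWord_append, barWord_cons, List.append_assoc, List.cons_append,
    List.nil_append] at this
  -- Barring both words turns the right context into a left one, with `c*` now in the role of `a`
  -- and `a*` in that of `c`.
  have hs := this.separating_left (by simpa using hca.symm) (by simpa [count_barWord] using hw) (by
    simp [hca] at ca
    simp [count_barWord]
    omega)
  simpa using hs.bar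

/-! ### Deduction -/

section Deduction

variable {E : Set Identity}

theorem Deducible.refl (r : Term) : Deducible E (r, r) := Relation.EqvGen.refl r

theorem Deducible.symm {r q : Term} (e : Deducible E (r, q)) : Deducible E (q, r) :=
  Relation.EqvGen.symm _ _ e

theorem Deducible.trans {r q p : Term} (e : Deducible E (r, q)) (e' : Deducible E (q, p)) :
    Deducible E (r, p) := Relation.EqvGen.trans _ _ _ e e'

theorem Deducible.map {f : Term → Term}
    (hf : ∀ {r q}, DirectlyDeducible E r q → DirectlyDeducible E (f r) (f q)) {r q : Term}
    (e : Deducible E (r, q)) : Deducible E (f r, f q) := by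
  change Relation.EqvGen _ r q at e
  induction e with
  | rel _ _ e => exact .rel _ _ (hf e)
  | refl _ => exact .refl _
  | symm _ _ _ ih => exact .symm ih
  | trans _ _ _ _ _ ih ih' => exact .trans ih ih'

theorem Deducible.mul {r q r' q' : Term} (e : Deducible E (r, q)) (e' : Deducible E (r', q')) :
    Deducible E (r.mul r', q.mul q') :=
  (e.map (f := fun p => p.mul r') (.mul_right _)).trans (e'.map (.mul_left _))

theorem Deducible.star {r q : Term} (e : Deducible E (r, q)) : Deducible E (r.star, q.star) :=
  e.map .star

theorem Deducible.assoc (r q p : Term) : Deducible E ((r.mul q).mul p, r.mul (q.mul p)) :=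
  .rel _ _ (.assoc _ _ _)

theorem Deducible.one_mul (r : Term) : Deducible E (Term.one.mul r, r) :=
  .rel _ _ (.one_mul _)

theorem Deducible.mul_one (r : Term) : Deducible E (r.mul .one, r) :=
  .rel _ _ (.mul_one _)

theorem deducible_wordTerm_append (u v : List Letter) :
    Deducible E ((wordTerm u).mul (wordTerm v), wordTerm (u ++ v)) := by
  induction u with
  | nil => exact .one_mul _
  | cons a u ih => exact (Deducible.assoc _ _ _).trans (.mul (.refl _) ih)

/-- The words `u` and `v` are joined by a deduction from `E`. -/
def WordDeducible (E : Set Identity) (u v : List Letter) : Prop :=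
  Deducible E (wordTerm u, wordTerm v)

theorem WordDeducible.append_append {u v : List Letter} (e : WordDeducible E u v)
    (p q : List Letter) : WordDeducible E (p ++ u ++ q) (p ++ v ++ q) := by
  have e1 (w : List Letter) :
      Deducible E (((wordTerm p).mul (wordTerm w)).mul (wordTerm q), wordTerm (p ++ w ++ q)) :=
    .trans (.mul (deducible_wordTerm_append _ _) (.refl _)) (deducible_wordTerm_append _ _)
  exact (e1 u).symm.trans (.trans (.mul (.mul (.refl _) e) (.refl _)) (e1 v))

/-! ### Reduction of terms to words -/

/-- The word represented by a term. -/
def Term.toWord : Term → List Letter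
  | .var i => [.plain i]
  | .one => []
  | .mul r q => r.toWord ++ q.toWord
  | .star r => barWord r.toWord

/-- Apply a substitution of words for variables to a letter. -/
def letterSubst (ψ : ℕ → List Letter) : Letter → List Letter
  | .plain i => ψ i
  | .starred i => barWord (ψ i)

/-- Apply a substitution of words for variables to a word. -/
def wordSubst (ψ : ℕ → List Letter) (w : List Letter) : List Letter := w.flatMap (letterSubst ψ)

theorem toWord_subst_wordTerm (ψ : ℕ → List Letter) (w : List Letter) :
    ((wordTerm w).subst fun i => wordTerm (ψ i)).toWord =
      wordSubst (fun i => (wordTerm (ψ i)).toWord) w := by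
  induction w with
  | nil => rfl
  | cons a w ih => cases a <;> exact congrArg _ ih

theorem toWord_wordTerm (w : List Letter) : (wordTerm w).toWord = w := by
  induction w with
  | nil => rfl
  | cons a w ih => cases a <;> exact congrArg _ ih

section Involution

variable (hE : involutionAxioms ⊆ E)
include hE

theorem deducible_star_star (r : Term) : Deducible E (r.star.star, r) :=
  .rel _ _ (.inst (.star (.star (.var 0)), .var 0) (hE (.inl rfl)) fun _ => r)

theorem deducible_star_mul (r q : Term) : Deducible E ((r.mul q).star, q.star.mul r.star) :=
  .rel _ _ (.inst (.star (.mul (.var 0) (.var 1)), .mul (.star (.var 1)) (.star (.var 0)))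
    (hE (.inr rfl)) fun i => if i = 0 then r else q)

/-- Unit preservation is not an axiom but follows: `1* ≈ 1* 1** ≈ (1* 1)* ≈ 1** ≈ 1`. -/
theorem deducible_star_one : Deducible E (Term.one.star, .one) := by
  have e1 : Deducible E (Term.one.star.mul Term.one.star.star, .one) :=
    (deducible_star_mul hE _ _).symm.trans
      ((Deducible.mul_one _).star.trans (deducible_star_star hE _))
  exact ((Deducible.mul_one _).symm.trans (.mul (.refl _) (deducible_star_star hE _).symm)).trans e1

theorem deducible_star_wordTerm (w : List Letter) :
    Deducible E ((wordTerm w).star, wordTerm (barWord w)) := by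
  induction w with
  | nil => exact deducible_star_one hE
  | cons a w ih =>
    rw [barWord_cons]
    refine .trans (deducible_star_mul hE _ _) (.trans ?_ (deducible_wordTerm_append _ _))
    refine .mul ih (.trans ?_ (Deducible.mul_one _).symm)
    cases a
    · exact .refl _
    · exact deducible_star_star hE _

theorem deducible_toWord (r : Term) : Deducible E (r, wordTerm r.toWord) := by
  induction r with
  | var i => exact (Deducible.mul_one _).symm
  | one => exact .refl _
  | mul r q ihr ihq => exact (ihr.mul ihq).trans (deducible_wordTerm_append _ _)
  | star r ih => exact ih.star.trans (deducible_star_wordTerm hE _)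

theorem wordDeducible_subst {p : List Letter × List Letter} (hp : wordIdentity p ∈ E)
    (ψ : ℕ → List Letter) : WordDeducible E (wordSubst ψ p.1) (wordSubst ψ p.2) := by
  have e1 (w : List Letter) :
      Deducible E ((wordTerm w).subst fun i => wordTerm (ψ i), wordTerm (wordSubst ψ w)) := by
    have := deducible_toWord hE ((wordTerm w).subst fun i => wordTerm (ψ i))
    rw [toWord_subst_wordTerm] at this
    simpa only [toWord_wordTerm] using this
  exact (e1 _).symm.trans (.trans (.rel _ _ (.inst _ hp fun i => wordTerm (ψ i))) (e1 _))

end Involution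

end Deduction

theorem eval_toWord {S : Type*} [Monoid S] [StarMul S] (φ : ℕ → S) (r : Term) :
    (wordTerm r.toWord).eval φ = r.eval φ := by
  have e1 (u v : List Letter) :
      (wordTerm (u ++ v)).eval φ = (wordTerm u).eval φ * (wordTerm v).eval φ := by
    induction u with
    | nil => exact (one_mul _).symm
    | cons a u ih => exact (congrArg _ ih).trans (mul_assoc _ _ _).symm
  have e2 (w : List Letter) : (wordTerm (barWord w)).eval φ = star ((wordTerm w).eval φ) := by
    induction w with
    | nil => exact (star_one S).symm
    | cons a w ih =>
      rw [barWord_cons, e1, ih]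
      refine .trans ?_ (star_mul _ _).symm
      refine congrArg _ ((mul_one _).trans ?_)
      cases a
      · rfl
      · exact (star_star _).symm
  induction r with
  | var i => exact mul_one _
  | one => rfl
  | mul r q ihr ihq => exact (e1 _ _).trans (by rw [ihr, ihq]; rfl)
  | star r ih => exact (e2 _).trans (by rw [ih]; rfl)

/-! ### The basis -/

/-- The word identities of the basis. -/
def basisWordIdentities : List (List Letter × List Letter) :=
  baxterTwoIdentities ++ baxterTwoIdentities.map reverseIdentity

theorem baxterTwoBasis_eq :
    baxterTwoBasis = involutionAxioms ∪ wordIdentity '' {p | p ∈ basisWordIdentities} := by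
  ext e
  simp only [baxterTwoBasis, basisWordIdentities, Set.mem_union, Set.mem_ofPred_eq, Set.mem_image,
    List.mem_append, List.mem_map, or_assoc]
  refine or_congr Iff.rfl ⟨?_, ?_⟩
  · rintro (⟨p, hp, rfl⟩ | ⟨p, hp, rfl⟩)
    · exact ⟨p, .inl hp, rfl⟩
    · exact ⟨_, .inr ⟨p, hp, rfl⟩, rfl⟩
  · rintro ⟨_, hp | ⟨p, hp, rfl⟩, rfl⟩
    · exact .inl ⟨_, hp, rfl⟩
    · exact .inr ⟨p, hp, rfl⟩

theorem finite_baxterTwoBasis : baxterTwoBasis.Finite := by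
  rw [baxterTwoBasis_eq]
  exact (Set.toFinite {_, _}).union ((List.finite_toSet basisWordIdentities).image _)

theorem involutionAxioms_subset : involutionAxioms ⊆ baxterTwoBasis :=
  baxterTwoBasis_eq ▸ Set.subset_union_left

/-- Soundness of the word identities becomes a finite check: each exchanges the letters at positions
4 and 5 of a ten-letter word, in separating contexts. The default `x` is never reached. -/
theorem basisWordIdentities_separating : ∀ p ∈ basisWordIdentities,
    p.1 = p.1.take 4 ++ [p.1.getD 4 x, p.1.getD 5 x] ++ p.1.drop 6 ∧
    p.2 = p.1.take 4 ++ [p.1.getD 5 x, p.1.getD 4 x] ++ p.1.drop 6 ∧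
    Separating (p.1.getD 4 x) (p.1.getD 5 x) (p.1.take 4) ∧
    Separating (p.1.getD 4 x) (p.1.getD 5 x) (p.1.drop 6) := by
  decide

theorem satisfies_of_mem_baxterTwoBasis {e : Identity} (he : e ∈ baxterTwoBasis) :
    Satisfies (BaxterMonoid 2) e := by
  rw [baxterTwoBasis_eq] at he
  rcases he with (rfl | rfl) | ⟨p, hp, rfl⟩
  · exact fun φ => star_star _
  · exact fun φ => star_mul _ _
  · obtain ⟨e1, e2, hl, hr⟩ := basisWordIdentities_separating p hp
    rw [satisfies_wordIdentity_iff, e2]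
    nth_rewrite 1 [e1]
    exact wordHolds_swap hl hr

/-! ### Exchanges in separating contexts as instances of the basis -/

/-- The pairs of letters that separate `x` and `y`. -/
def separatingPairs : List (Letter × Letter) :=
  [(x, x'), (x', x), (y, y'), (y', y), (x, y), (y, x), (x', y'), (y', x')]

/-- The exchange of `x` and `y` in a context given by two pairs of letters. -/
def contextIdentity (l r : Letter × Letter) : List Letter × List Letter :=
  ([l.1, h, l.2, k, x, y, s, r.1, t, r.2], [l.1, h, l.2, k, y, x, s, r.1, t, r.2])

/-- Rename the variable of a letter; a renaming is given by the list of its values. -/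
def Letter.rename (f : List ℕ) : Letter → Letter
  | .plain i => .plain (f.getD i 0)
  | .starred i => .starred (f.getD i 0)

theorem wordSubst_rename (ψ : ℕ → List Letter) (f : List ℕ) (w : List Letter) :
    wordSubst ψ (w.map (Letter.rename f)) = wordSubst (fun i => ψ (f.getD i 0)) w := by
  induction w with
  | nil => rfl
  | cons a w ih => cases a <;> exact congrArg _ ih

set_option maxRecDepth 10000 in
-- The basis lists the 64 contexts only up to symmetry. The renamings exchange `x` with `y`, or
-- reverse the order of `h, k, s, t` to match a reversed identity, or both; the two sides may trade
-- places, whence the disjunction.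
theorem contextIdentity_eq_rename : ∀ l ∈ separatingPairs, ∀ r ∈ separatingPairs,
    ∃ p ∈ basisWordIdentities,
    ∃ f ∈ [[0, 1, 2, 3, 4, 5], [1, 0, 2, 3, 4, 5], [0, 1, 5, 4, 3, 2], [1, 0, 5, 4, 3, 2]],
      (p.1.map (Letter.rename f) = (contextIdentity l r).1 ∧
        p.2.map (Letter.rename f) = (contextIdentity l r).2) ∨
      (p.1.map (Letter.rename f) = (contextIdentity l r).2 ∧
        p.2.map (Letter.rename f) = (contextIdentity l r).1) := by
  decide

theorem wordDeducible_contextIdentity {l r : Letter × Letter} (hl : l ∈ separatingPairs)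
    (hr : r ∈ separatingPairs) (ψ : ℕ → List Letter) :
    WordDeducible baxterTwoBasis (wordSubst ψ (contextIdentity l r).1)
      (wordSubst ψ (contextIdentity l r).2) := by
  obtain ⟨p, hp, f, -, e⟩ := contextIdentity_eq_rename l hl r hr
  have hp' : wordIdentity p ∈ baxterTwoBasis := by
    rw [baxterTwoBasis_eq]
    exact .inr ⟨p, hp, rfl⟩
  have := wordDeducible_subst involutionAxioms_subset hp' fun i => ψ (f.getD i 0)
  rw [← wordSubst_rename, ← wordSubst_rename] at this
  rcases e with ⟨e1, e2⟩ | ⟨e1, e2⟩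
  · rwa [e1, e2] at this
  · rw [e1, e2] at this
    exact this.symm

/-- Replace `x` by `a` and `y` by `b`. -/
def pairLetter (a b : Letter) : Letter → Letter
  | .plain i => if i = 0 then a else b
  | .starred i => if i = 0 then a.inv else b.inv

theorem exists_append_of_mem_of_mem {c d : Letter} {w : List Letter} (hcd : c ≠ d) (hc : c ∈ w)
    (hd : d ∈ w) : (∃ p q r, w = p ++ c :: q ++ d :: r) ∨ ∃ p q r, w = p ++ d :: q ++ c :: r := by
  obtain ⟨p, q, rfl⟩ := List.append_of_mem hc
  rcases List.mem_append.1 hd with h1 | h1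
  · obtain ⟨p₁, p₂, rfl⟩ := List.append_of_mem h1
    exact .inr ⟨p₁, p₂, q, rfl⟩
  · obtain ⟨q₁, q₂, rfl⟩ := List.append_of_mem ((List.mem_cons.1 h1).resolve_left hcd.symm)
    exact .inl ⟨p, q₁, q₂, by simp⟩

theorem Separating.exists_pair {a b : Letter} {w : List Letter} (hab : a ≠ b)
    (hw : Separating a b w) : ∃ l ∈ separatingPairs, ∃ p q r,
      w = p ++ pairLetter a b l.1 :: q ++ pairLetter a b l.2 :: r := by
  rcases hw with ⟨h1, h2⟩ | ⟨h1, h2⟩ | ⟨h1, h2⟩ | ⟨h1, h2⟩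
  · rcases exists_append_of_mem_of_mem (Letter.ne_inv_self a) h1 h2 with e | e
    · exact ⟨(x, x'), by decide, e⟩
    · exact ⟨(x', x), by decide, e⟩
  · rcases exists_append_of_mem_of_mem (Letter.ne_inv_self b) h1 h2 with e | e
    · exact ⟨(y, y'), by decide, e⟩
    · exact ⟨(y', y), by decide, e⟩
  · rcases exists_append_of_mem_of_mem hab h1 h2 with e | e
    · exact ⟨(x, y), by decide, e⟩
    · exact ⟨(y, x), by decide, e⟩
  · rcases exists_append_of_mem_of_mem (by simpa using hab) h1 h2 with e | e
    · exact ⟨(x', y'), by decide, e⟩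
    · exact ⟨(y', x'), by decide, e⟩

theorem wordDeducible_swap {a b : Letter} (hab : a ≠ b) {p q : List Letter}
    (hp : Separating a b p) (hq : Separating a b q) :
    WordDeducible baxterTwoBasis (p ++ [a, b] ++ q) (p ++ [b, a] ++ q) := by
  obtain ⟨l, hl, p₁, p₂, p₃, rfl⟩ := hp.exists_pair hab
  obtain ⟨r, hr, q₁, q₂, q₃, rfl⟩ := hq.exists_pair hab
  -- The entries are the values of `x, y, h, k, s, t`. The outer pieces `p₁` and `q₃` stay outside
  -- the instance.
  let ψ : ℕ → List Letter := fun i => [[a], [b], p₂, p₃, q₁, q₂].getD i []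
  have hψ : ∀ l ∈ separatingPairs, letterSubst ψ l.1 = [pairLetter a b l.1] ∧
      letterSubst ψ l.2 = [pairLetter a b l.2] := by
    simp only [separatingPairs, List.forall_mem_cons]
    exact ⟨⟨rfl, rfl⟩, ⟨rfl, rfl⟩, ⟨rfl, rfl⟩, ⟨rfl, rfl⟩, ⟨rfl, rfl⟩, ⟨rfl, rfl⟩, ⟨rfl, rfl⟩,
      ⟨rfl, rfl⟩, by simp⟩
  have := (wordDeducible_contextIdentity hl hr ψ).append_append p₁ q₃
  simp only [contextIdentity, wordSubst, List.flatMap_cons, List.flatMap_nil, hψ l hl,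
    hψ r hr] at this
  simpa [letterSubst, ψ, x, y, h, k, s, t] using this

/-! ### Completeness -/

/-- The letter `a` moves left across `r` one letter at a time. Each exchange is sound as well as
deducible, so the identity with the fixed word `p ++ a :: u` persists and the invariants apply again
at the next exchange. -/
theorem wordDeducible_move (p u q : List Letter) (a : Letter) {r : List Letter} (hr : a ∉ r)
    (huv : WordHolds (p ++ a :: u) (p ++ r ++ a :: q)) :
    WordDeducible baxterTwoBasis (p ++ r ++ a :: q) (p ++ a :: (r ++ q)) ∧
      WordHolds (p ++ a :: u) (p ++ a :: (r ++ q)) := by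
  induction r using List.reverseRecOn generalizing q with
  | nil =>
    rw [List.append_nil] at huv ⊢
    exact ⟨.refl _, huv⟩
  | append_singleton r c ih =>
    simp only [List.mem_append, List.mem_singleton, not_or] at hr
    have huv' : WordHolds (p ++ a :: u) ((p ++ r) ++ c :: a :: q) := by simpa using huv
    -- Since `r` avoids `a`, the displayed `a` is the same occurrence in both words, as the
    -- separation lemmas require.
    have ha : p.count a = (p ++ r).count a := by simp [List.count_eq_zero.2 hr.1]
    have hc : p.count c ≤ (p ++ r).count c := by simp
    have hl := huv'.separating_left (Ne.symm hr.2) ha hc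
    have hq := huv'.separating_right (Ne.symm hr.2) ha hc
    have e1 := wordDeducible_swap (Ne.symm hr.2) hl hq
    have e2 := wordHolds_swap hl hq
    have e3 : (p ++ r) ++ [c, a] ++ q = p ++ (r ++ [c]) ++ a :: q := by simp
    have e4 : (p ++ r) ++ [a, c] ++ q = p ++ r ++ a :: (c :: q) := by simp
    rw [e3, e4] at e1 e2
    obtain ⟨e5, e6⟩ := ih (c :: q) hr.1 (huv.trans e2)
    rw [show r ++ [c] ++ q = r ++ c :: q by simp]
    exact ⟨e1.trans e5, e6⟩

/-- The common prefix `p` grows by one letter of `u` at each step. It must be kept, since it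
supplies part of the left context of later exchanges and identities cannot simply be cancelled. -/
theorem wordDeducible_of_wordHolds_append (u v p : List Letter)
    (huv : WordHolds (p ++ u) (p ++ v)) :
    WordDeducible baxterTwoBasis (p ++ u) (p ++ v) := by
  induction u generalizing v p with
  | nil =>
    have : v = [] := List.eq_nil_iff_forall_not_mem.2 fun a => by
      have := huv.count_eq a
      simpa [List.count_eq_zero] using this.symm
    exact this ▸ .refl _
  | cons a u ih =>
    have hv : a ∈ v := by
      have := huv.count_eq a
      simp only [List.count_append, List.count_cons_self] at this
      exact List.count_pos_iff.1 (by omega)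
    -- The first occurrence of `a` in `v` is taken, so that `a` never has to cross another copy of
    -- itself.
    obtain ⟨r, q, rfl, hr⟩ := List.eq_append_cons_of_mem hv
    rw [← List.append_assoc] at huv ⊢
    obtain ⟨e1, e2⟩ := wordDeducible_move p u q a hr huv
    have e3 := ih (r ++ q) (p ++ [a]) (by simpa using e2)
    simp only [List.append_assoc, List.singleton_append] at e3
    exact e3.trans (by simpa using e1.symm)

theorem isIdentityBasis_baxterTwoBasis : IsIdentityBasis (BaxterMonoid 2) baxterTwoBasis := by
  refine ⟨fun e he => satisfies_of_mem_baxterTwoBasis he, fun e he => ?_⟩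
  have hw : WordHolds e.1.toWord e.2.toWord :=
    (satisfies_wordIdentity_iff (e.1.toWord, e.2.toWord)).1 fun φ => by
      simpa only [wordIdentity, eval_toWord] using he φ
  have hd : WordDeducible baxterTwoBasis e.1.toWord e.2.toWord :=
    wordDeducible_of_wordHolds_append _ _ [] hw
  exact (deducible_toWord involutionAxioms_subset _).trans
    (hd.trans (deducible_toWord involutionAxioms_subset _).symm)

end BaxterInvolution

theorem mainTheorem3 :
    BaxterInvolution.baxterTwoBasis.Finite ∧
      BaxterInvolution.IsIdentityBasis (BaxterInvolution.BaxterMonoid 2)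
        BaxterInvolution.baxterTwoBasis ∧
      BaxterInvolution.IsFinitelyBased (BaxterInvolution.BaxterMonoid 2) :=
  ⟨BaxterInvolution.finite_baxterTwoBasis, BaxterInvolution.isIdentityBasis_baxterTwoBasis,
    _, BaxterInvolution.finite_baxterTwoBasis, BaxterInvolution.isIdentityBasis_baxterTwoBasis⟩
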